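/- Let $0<\alpha\le 2$ and let $X_1,X_2,\dots$ be i.i.d. random variables with distribution function $F(x)=1-x^{-\alpha}$ for $x\ge 1$. Let $0\le\beta<1/2$ and let $(b_n)_{n\ge1}$ be a positive nondecreasing sequence with $b_n\to\infty$ such that $b_n^{\alpha}\ln b_n\le \alpha n^{1-2\beta}/\ln n$ for all sufficiently large $n$. Write $X_k(b_n)=X_k\mathbf 1\{X_k\le b_n\}$ and $$\mu_n=E[X_1(b_n)],\quad \hat\mu_n=\frac1n\sum_{k=1}^n X_k(b_n),\quad \nu_n^2=E[X_1(b_n)^2],\quad \hat\nu_n^2=\frac1n\sum_{k=1}^n X_k(b_n)^2 .$$ (i) If $0<\alpha\le 1$, then for all sufficiently large $n$ $$P\Big(\frac{|\hat\mu_n-\mu_n|}{\mu_n}\ge\frac{2}{n^{\beta}\sqrt{\ln b_n}}\Big)\le\frac{2}{n^2},$$ and, as $n\to\infty$, $\ \sqrt n\,(\hat\mu_n-\mu_n)/b_n^{1-\alpha/2}\Rightarrow N\big(0,\tfrac{\alpha}{2-\alpha}\big)$. (ii) If $1<\alpha\le 2$, then for all sufficiently large $n$ $$P\Big(\frac{|\hat\nu_n^2-\nu_n^2|}{\nu_n^2}\ge\frac{2}{n^{\beta}\sqrt{\ln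 b_n}}\Big)\le\frac{2}{n^2},$$ and, as $n\to\infty$, $\ \sqrt n\,(\hat\nu_n^2-\nu_n^2)/b_n^{2-\alpha/2}\Rightarrow N\big(0,\tfrac{\alpha}{4-\alpha}\big)$. Here $\Rightarrow$ denotes convergence in distribution and $N(0,\sigma^2)$ is the normal law with mean $0$ and variance $\sigma^2$. -/

import Mathlib

open MeasureTheory ProbabilityTheory Filter

noncomputable section

/-- The truncated random variable `X · 1{X ≤ c}`. -/
def truncRV {Ω : Type*} (X : Ω → ℝ) (c : ℝ) : Ω → ℝ :=
  Set.indicator {ω | X ω ≤ c} X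

/-- The truncated `p`-th moment `E[(X · 1{X ≤ c}) ^ p]`: the truncated mean for `p = 1`, the
truncated second moment for `p = 2`. -/
def truncMoment {Ω : Type*} [MeasurableSpace Ω] (P : Measure Ω) (X : Ω → ℝ) (p : ℕ) (c : ℝ) : ℝ :=
  ∫ ω, truncRV X c ω ^ p ∂P

/-- The truncated sample `p`-th moment of the first `n` samples `X 0, …, X (n - 1)`, that is
`n⁻¹ ∑ (X k · 1{X k ≤ c}) ^ p`. -/
def truncSampleMoment {Ω : Type*} (X : ℕ → Ω → ℝ) (p n : ℕ) (c : ℝ) : Ω → ℝ :=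
  fun ω => (n : ℝ)⁻¹ * ∑ k ∈ Finset.range n, truncRV (X k) c ω ^ p

/-- A sequence `b 1, b 2, …` of truncation levels: positive, nondecreasing, tending to infinity.
The value `b 0` plays no role. -/
structure IsTruncationSequence (b : ℕ → ℝ) : Prop where
  pos : ∀ n, 1 ≤ n → 0 < b n
  mono : MonotoneOn b (Set.Ici 1)
  tendsto : Tendsto b atTop atTop

end

/-! Both cases are one statement for a power `p ≥ α` (`p = 1` or `p = 2`). Write `c = b n` and let
`m` be the truncated `p`-th moment. The truncated powers lie in `[0, c ^ p]`, their second moment is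
at most `σ c ^ (2p - α)` with `σ = α / (2p - α)`, and eventually `m ≥ q c ^ (p - α)` for any `q`
with `q (p - α) < α`.

Concentration: Chernoff's bound at relative deviation `ε` gives `2 exp(-n q² ε² / (2 σ (1 + δ) c ^
α))`, where `δ` pays for the Taylor remainder. The growth condition says `α n ε² ≥ 4 c ^ α log n`,
so the exponent is at most `-2 log n` once `q² ≥ σ α (1 + δ)`. Such `q` and `δ > 0` exist when `(p -
α)² < 2p - α` (`exists_moment_constant`).

Normality: divided by `√n c ^ (p - α/2)`, the centred summands are bounded by `c ^ (α/2) / √n → 0`,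
and `n` times their variance tends to `σ` because `m²` is negligible against `c ^ (2p - α)`. A
characteristic function argument for triangular arrays finishes
(`tendstoInDistribution_sum_of_bounded_rows`). -/

/-! ### Second-order expansions of the exponential, with the cubic remainder absorbed as `|x| ^ 3 ≤
δ x ^ 2`. -/

lemma Real.exp_le_one_add_add_sq {x δ : ℝ} (hx : |x| ≤ δ) (hδ : δ ≤ 1) :
    Real.exp x ≤ 1 + x + x ^ 2 / 2 * (1 + δ) := by
  have h := (abs_le.1 (Real.exp_bound (x := x) (hx.trans hδ) (n := 3) (by norm_num))).2
  simp only [Finset.sum_range_succ, Finset.sum_range_zero, Nat.factorial] at h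
  norm_num at h
  have h2 : |x| ^ 3 ≤ x ^ 2 * δ := by
    rw [pow_succ, sq_abs]; gcongr
  nlinarith [mul_nonneg (sq_nonneg x) ((abs_nonneg x).trans hx)]

lemma Complex.norm_exp_ofReal_mul_I_sub_le {x δ : ℝ} (hx : |x| ≤ δ) (hδ : δ ≤ 1) :
    ‖Complex.exp (x * Complex.I) - (1 + x * Complex.I - x ^ 2 / 2)‖ ≤ δ * x ^ 2 := by
  have hn : ‖(x * Complex.I : ℂ)‖ = |x| := by simp
  have h := Complex.exp_bound (x := x * Complex.I) (hn.le.trans (hx.trans hδ)) (n := 3)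
    (by norm_num)
  simp only [Finset.sum_range_succ, Finset.sum_range_zero, Nat.factorial] at h
  rw [hn] at h
  norm_num [mul_pow] at h
  have h2 : |x| ^ 3 ≤ x ^ 2 * δ := by
    rw [pow_succ, sq_abs]; gcongr
  have e : (1 + x * Complex.I - x ^ 2 / 2 : ℂ) = 1 + x * Complex.I + -(x : ℂ) ^ 2 / 2 := by ring
  rw [e]
  refine h.trans ?_
  nlinarith [mul_nonneg (sq_nonneg x) ((abs_nonneg x).trans hx)]

/-! ### Chernoff bound and central limit theorem for bounded i.i.d. rows. -/

section Bounded

variable {Ω : Type*} [MeasurableSpace Ω] {P : Measure Ω} [IsProbabilityMeasure P]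

lemma integrable_of_ae_abs_le {W : Ω → ℝ} {B : ℝ} (hW : AEMeasurable W P)
    (hB : ∀ᵐ ω ∂P, |W ω| ≤ B) : Integrable W P :=
  .of_bound hW.aestronglyMeasurable B hB

lemma integrable_sq_of_ae_abs_le {W : Ω → ℝ} {B : ℝ} (hW : AEMeasurable W P)
    (hB : ∀ᵐ ω ∂P, |W ω| ≤ B) : Integrable (fun ω => W ω ^ 2) P := by
  refine .of_bound (hW.pow_const 2).aestronglyMeasurable (B ^ 2) ?_
  filter_upwards [hB] with ω h
  rw [Real.norm_eq_abs, abs_pow]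
  gcongr

lemma integrable_exp_mul_of_ae_abs_le {W : Ω → ℝ} {B : ℝ} (hW : AEMeasurable W P)
    (hB : ∀ᵐ ω ∂P, |W ω| ≤ B) (t : ℝ) : Integrable (fun ω => Real.exp (t * W ω)) P := by
  refine .of_bound (by fun_prop) (Real.exp (|t| * B)) ?_
  filter_upwards [hB] with ω h
  rw [Real.norm_eq_abs, Real.abs_exp, Real.exp_le_exp]
  refine (le_abs_self _).trans ?_
  rw [abs_mul]
  gcongr

/-- A Bernstein-type bound on the moment generating function of a bounded centred variable. -/
lemma mgf_le_exp_of_ae_abs_le {W : Ω → ℝ} {B t δ : ℝ} (hW : AEMeasurable W P)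
    (hB : ∀ᵐ ω ∂P, |W ω| ≤ B) (h0 : ∫ ω, W ω ∂P = 0) (ht : |t| * B ≤ δ) (hδ : δ ≤ 1) :
    mgf W P t ≤ Real.exp (t ^ 2 * (∫ ω, W ω ^ 2 ∂P) / 2 * (1 + δ)) := by
  have i1 := integrable_of_ae_abs_le hW hB
  have i2 := integrable_sq_of_ae_abs_le hW hB
  calc mgf W P t
      ≤ ∫ ω, (1 + t * W ω + t ^ 2 / 2 * (1 + δ) * W ω ^ 2) ∂P := by
        refine integral_mono_ae (integrable_exp_mul_of_ae_abs_le hW hB t)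
          (((integrable_const _).add (i1.const_mul _)).add (i2.const_mul _)) ?_
        filter_upwards [hB] with ω h
        have : |t * W ω| ≤ δ := by
          rw [abs_mul]
          exact (mul_le_mul_of_nonneg_left h (abs_nonneg t)).trans ht
        refine (Real.exp_le_one_add_add_sq this hδ).trans (le_of_eq ?_)
        ring
    _ = t ^ 2 * (∫ ω, W ω ^ 2 ∂P) / 2 * (1 + δ) + 1 := by
        rw [integral_add (by fun_prop) (i2.const_mul _), integral_add (by fun_prop)
          (i1.const_mul _), integral_const_mul, integral_const_mul, h0]
        simp
        ring
    _ ≤ _ := Real.add_one_le_exp _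

/-- A two-sided Chernoff bound for sums of i.i.d. bounded centred variables. -/
lemma measureReal_le_abs_sum_le {W : ℕ → Ω → ℝ} (hW : iIndepFun W P)
    (hid : ∀ k, IdentDistrib (W k) (W 0) P P) {B S t δ : ℝ}
    (hB : ∀ k, ∀ᵐ ω ∂P, |W k ω| ≤ B) (h0 : ∫ ω, W 0 ω ∂P = 0)
    (hS : ∫ ω, W 0 ω ^ 2 ∂P ≤ S) (ht0 : 0 ≤ t) (ht : t * B ≤ δ) (hδ : δ ≤ 1) (hδ0 : 0 ≤ δ)
    (n : ℕ) (x : ℝ) :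
    P.real {ω | x ≤ |∑ k ∈ Finset.range n, W k ω|} ≤
      2 * Real.exp (-t * x + n * (t ^ 2 * S / 2 * (1 + δ))) := by
  have hm k : AEMeasurable (W k) P := (hid k).aemeasurable_fst
  have hsum : ∀ᵐ ω ∂P, |(∑ k ∈ Finset.range n, W k) ω| ≤ n * B := by
    filter_upwards [ae_all_iff.2 hB] with ω h
    rw [Finset.sum_apply]
    refine (Finset.abs_sum_le_sum_abs _ _).trans ?_
    refine (Finset.sum_le_sum fun k _ => h k).trans (le_of_eq ?_)
    simp
  -- Only `|s|` enters the bound, so it serves both tails, with `s = t` and `s = -t`.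
  have hmgf (s : ℝ) (hs : |s| = t) : mgf (∑ k ∈ Finset.range n, W k) P s ≤
      Real.exp (n * (t ^ 2 * S / 2 * (1 + δ))) := by
    rw [hW.mgf_sum₀ hm]
    have e k : mgf (W k) P s = mgf (W 0) P s := by
      rw [mgf, mgf]
      exact ((hid k).comp (u := fun y => Real.exp (s * y)) (by fun_prop)).integral_eq
    simp_rw [e]
    rw [Finset.prod_const, Finset.card_range, Real.exp_nat_mul]
    refine pow_le_pow_left₀ mgf_nonneg ?_ n
    refine (mgf_le_exp_of_ae_abs_le (hm 0) (hB 0) h0 (hs ▸ ht) hδ).trans ?_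
    rw [Real.exp_le_exp, ← hs, sq_abs]
    gcongr
  have hmS : AEMeasurable (∑ k ∈ Finset.range n, W k) P :=
    Finset.aemeasurable_sum _ fun k _ => hm k
  have hi (s : ℝ) := integrable_exp_mul_of_ae_abs_le hmS hsum s
  have h1 := measure_ge_le_exp_mul_mgf x ht0 (hi t)
  have h2 := measure_le_le_exp_mul_mgf (-x) (neg_nonpos.2 ht0) (hi (-t))
  calc P.real {ω | x ≤ |∑ k ∈ Finset.range n, W k ω|}
      ≤ P.real ({ω | x ≤ (∑ k ∈ Finset.range n, W k) ω} ∪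
          {ω | (∑ k ∈ Finset.range n, W k) ω ≤ -x}) := by
        refine measureReal_mono ?_ (measure_ne_top _ _)
        intro ω hω
        simp only [Set.mem_ofPred_eq, Set.mem_union, Finset.sum_apply] at hω ⊢
        exact (le_abs.1 hω).imp id fun h => by linarith
    _ ≤ _ := measureReal_union_le _ _
    _ ≤ Real.exp (-t * x) * Real.exp (n * (t ^ 2 * S / 2 * (1 + δ))) +
        Real.exp (-t * x) * Real.exp (n * (t ^ 2 * S / 2 * (1 + δ))) := by
        refine add_le_add (h1.trans ?_) (h2.trans ?_)
        · gcongr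
          exact hmgf t (abs_of_nonneg ht0)
        · rw [neg_neg, mul_neg, ← neg_mul]
          gcongr
          exact hmgf (-t) (by rw [abs_neg, abs_of_nonneg ht0])
    _ = _ := by rw [Real.exp_add]; ring

/-- Centring kills the linear term, and `|t W| ≤ δ` turns the third-order remainder into `δ` times
the second-order term. -/
lemma norm_charFun_map_sub_le {W : Ω → ℝ} {B t δ : ℝ} (hW : AEMeasurable W P)
    (hB : ∀ᵐ ω ∂P, |W ω| ≤ B) (h0 : ∫ ω, W ω ∂P = 0) (ht : |t| * B ≤ δ) (hδ : δ ≤ 1) :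
    ‖charFun (P.map W) t - (1 - ((t ^ 2 * (∫ ω, W ω ^ 2 ∂P) / 2 : ℝ) : ℂ))‖ ≤
      δ * (t ^ 2 * ∫ ω, W ω ^ 2 ∂P) := by
  have i1 := integrable_of_ae_abs_le hW hB
  have i2 := integrable_sq_of_ae_abs_le hW hB
  have c1 : ∫ ω, ((t * W ω : ℝ) : ℂ) * Complex.I ∂P = 0 := by
    rw [integral_mul_const, integral_complex_ofReal, integral_const_mul, h0]
    simp
  have c2 : ∫ ω, (((t * W ω : ℝ) : ℂ) ^ 2 / 2 : ℂ) ∂P =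
      ((t ^ 2 * (∫ ω, W ω ^ 2 ∂P) / 2 : ℝ) : ℂ) := by
    rw [← integral_const_mul, ← integral_div, ← integral_complex_ofReal]
    congr 1; ext ω; push_cast; ring
  have j1 : Integrable (fun ω => ((t * W ω : ℝ) : ℂ) * Complex.I) P :=
    ((i1.const_mul t).ofReal (𝕜 := ℂ)).mul_const _
  have j2 : Integrable (fun ω => (((t * W ω : ℝ) : ℂ) ^ 2 / 2 : ℂ)) P := by
    have := ((i2.const_mul (t ^ 2 / 2)).ofReal (𝕜 := ℂ))
    refine this.congr (ae_of_all _ fun ω => ?_)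
    change ((t ^ 2 / 2 * W ω ^ 2 : ℝ) : ℂ) = _
    push_cast; ring
  have j3 : Integrable (fun ω => Complex.exp ((t * W ω : ℝ) * Complex.I)) P := by
    refine .of_bound (by fun_prop) 1 (ae_of_all _ fun ω => ?_)
    rw [Complex.norm_exp_ofReal_mul_I]
  have e1 : charFun (P.map W) t = ∫ ω, Complex.exp ((t * W ω : ℝ) * Complex.I) ∂P := by
    rw [charFun_apply_real, integral_map hW (by fun_prop)]
    simp
  have e2 : charFun (P.map W) t - (1 - ((t ^ 2 * (∫ ω, W ω ^ 2 ∂P) / 2 : ℝ) : ℂ)) =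
      ∫ ω, (Complex.exp ((t * W ω : ℝ) * Complex.I) -
        (1 + ((t * W ω : ℝ) : ℂ) * Complex.I - ((t * W ω : ℝ) : ℂ) ^ 2 / 2)) ∂P := by
    have j4 : Integrable (fun ω => 1 + ((t * W ω : ℝ) : ℂ) * Complex.I) P :=
      (integrable_const _).add j1
    have j5 : Integrable (fun ω => 1 + ((t * W ω : ℝ) : ℂ) * Complex.I -
        ((t * W ω : ℝ) : ℂ) ^ 2 / 2) P := j4.sub j2
    rw [integral_sub j3 j5, integral_sub j4 j2, integral_add (integrable_const _) j1, c1, c2, e1]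
    simp
  rw [e2, ← integral_const_mul, ← integral_const_mul]
  refine norm_integral_le_of_norm_le ((i2.const_mul _).const_mul _) ?_
  filter_upwards [hB] with ω h
  have : |t * W ω| ≤ δ := by
    rw [abs_mul]
    exact (mul_le_mul_of_nonneg_left h (abs_nonneg t)).trans ht
  refine (Complex.norm_exp_ofReal_mul_I_sub_le this hδ).trans (le_of_eq ?_)
  ring

/-- The central limit theorem for triangular arrays with i.i.d. centred rows whose entries are
uniformly small. -/
theorem tendstoInDistribution_sum_of_bounded_rows {W : ℕ → ℕ → Ω → ℝ} {δ : ℕ → ℝ} {v : ℝ}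
    (hv : 0 ≤ v) (hindep : ∀ n, iIndepFun (W n) P)
    (hid : ∀ n k, IdentDistrib (W n k) (W n 0) P P)
    (hB : ∀ᶠ n in atTop, ∀ᵐ ω ∂P, |W n 0 ω| ≤ δ n) (hδ : Tendsto δ atTop (nhds 0))
    (h0 : ∀ᶠ n in atTop, ∫ ω, W n 0 ω ∂P = 0)
    (hvar : Tendsto (fun n : ℕ => n * ∫ ω, W n 0 ω ^ 2 ∂P) atTop (nhds v)) :
    TendstoInDistribution (fun n ω => ∑ k ∈ Finset.range n, W n k ω) atTop (id : ℝ → ℝ)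
      (fun _ => P) (gaussianReal 0 v.toNNReal) where
  forall_aemeasurable n :=
    Finset.aemeasurable_fun_sum _ fun k _ => (hid n k).aemeasurable_fst
  tendsto := by
    refine ProbabilityMeasure.tendsto_iff_tendsto_charFun.2 fun t => ?_
    simp only [Measure.map_id, ProbabilityMeasure.coe_mk]
    rw [charFun_gaussianReal]
    have hcf n : charFun (P.map fun ω => ∑ k ∈ Finset.range n, W n k ω) t =
        (1 + (charFun (P.map (W n 0)) t - 1)) ^ n := by
      rw [((hindep n).restrict _).charFun_map_fun_finsetSum_eq_prod
        (fun k _ => (hid n k).aemeasurable_fst)]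
      simp [fun k => (hid n k).map_eq]
    simp_rw [hcf]
    -- It remains to show `n (φ_n(t) - 1) → -t² v / 2`, where `φ_n` is the characteristic function
    -- of one entry.
    refine Complex.tendsto_one_add_pow_exp_of_tendsto ?_
    have hlim : Tendsto (fun n : ℕ => ((-(t ^ 2 / 2 * (n * ∫ ω, W n 0 ω ^ 2 ∂P)) : ℝ) : ℂ)) atTop
        (nhds ((-(t ^ 2 / 2 * v) : ℝ) : ℂ)) :=
      (Complex.continuous_ofReal.tendsto _).comp (hvar.const_mul _).neg
    have hz : Tendsto (fun n : ℕ => |t| * |δ n| * (t ^ 2 * (n * ∫ ω, W n 0 ω ^ 2 ∂P))) atTop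
        (nhds 0) := by
      have := ((hδ.abs).const_mul |t|).mul (hvar.const_mul (t ^ 2))
      simpa using this
    have hsmall : ∀ᶠ n in atTop, |t| * |δ n| ≤ 1 := by
      have : Tendsto (fun n => |t| * |δ n|) atTop (nhds 0) := by
        simpa using (hδ.abs).const_mul |t|
      exact this.eventually_le_const one_pos
    have hdiff : Tendsto (fun n : ℕ => (n : ℂ) * (charFun (P.map (W n 0)) t - 1) -
        ((-(t ^ 2 / 2 * (n * ∫ ω, W n 0 ω ^ 2 ∂P)) : ℝ) : ℂ)) atTop (nhds 0) := by
      refine squeeze_zero_norm' ?_ hz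
      filter_upwards [hB, h0, hsmall] with n h1 h2 h3
      have key := norm_charFun_map_sub_le (t := t) (δ := |t| * |δ n|)
        (hid n 0).aemeasurable_fst h1 h2 (by gcongr; exact le_abs_self _) h3
      have e : (n : ℂ) * (charFun (P.map (W n 0)) t - 1) -
          ((-(t ^ 2 / 2 * (n * ∫ ω, W n 0 ω ^ 2 ∂P)) : ℝ) : ℂ) =
          n * (charFun (P.map (W n 0)) t - (1 - (t ^ 2 * (∫ ω, W n 0 ω ^ 2 ∂P) / 2 : ℝ))) := by
        push_cast; ring
      rw [e, norm_mul, Complex.norm_natCast]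
      refine (mul_le_mul_of_nonneg_left key (Nat.cast_nonneg n)).trans (le_of_eq ?_)
      ring
    have := hdiff.add hlim
    simp only [sub_add_cancel, zero_add] at this
    convert this using 2
    push_cast [Real.coe_toNNReal v hv]
    simp
    ring

end Bounded

/-! ### Truncated moments of the Pareto law and their asymptotics. -/

lemma truncRV_apply {Ω : Type*} (X : Ω → ℝ) (c : ℝ) (ω : Ω) :
    truncRV X c ω = truncRV id c (X ω) := rfl

lemma measurable_truncRV_id (c : ℝ) : Measurable (truncRV (id : ℝ → ℝ) c) :=
  measurable_id.indicator measurableSet_Iic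

lemma truncMoment_eq_of_hasLaw {Ω : Type*} [MeasurableSpace Ω] {P : Measure Ω} {X : Ω → ℝ}
    {μ : Measure ℝ} (hX : HasLaw X μ P) (p : ℕ) (c : ℝ) :
    truncMoment P X p c = truncMoment μ id p c :=
  hX.integral_comp (f := fun x => truncRV id c x ^ p)
    ((measurable_truncRV_id c).pow_const p).aestronglyMeasurable

lemma measurable_paretoPDF (t r : ℝ) : Measurable (paretoPDF t r) :=
  (measurable_paretoPDFReal t r).ennreal_ofReal

lemma ae_one_le_paretoMeasure (α : ℝ) : ∀ᵐ x ∂paretoMeasure 1 α, 1 ≤ x := by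
  rw [paretoMeasure, ae_withDensity_iff (measurable_paretoPDF 1 α)]
  refine ae_of_all _ fun x hx => ?_
  by_contra h
  exact hx (paretoPDF_of_lt (not_le.1 h))

lemma truncMoment_paretoMeasure_eq_integral {α : ℝ} (hα : 0 < α) {p : ℕ} (hp : p ≠ 0) {c : ℝ}
    (hc : 1 ≤ c) :
    truncMoment (paretoMeasure 1 α) id p c = α * ∫ x in (1 : ℝ)..c, x ^ ((p : ℝ) - α - 1) := by
  rw [truncMoment, paretoMeasure, integral_withDensity_eq_integral_toReal_smul
    (measurable_paretoPDF 1 α)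
    (ae_of_all _ fun x => ENNReal.ofReal_lt_top), intervalIntegral.integral_of_le hc,
    ← integral_const_mul, ← integral_Icc_eq_integral_Ioc, ← integral_indicator measurableSet_Icc]
  congr 1
  ext x
  rw [paretoPDF, ENNReal.toReal_ofReal (paretoPDFReal_nonneg zero_le_one hα.le x)]
  by_cases h1 : 1 ≤ x
  · by_cases h2 : x ≤ c
    · have hx : 0 < x := by linarith
      rw [Set.indicator_of_mem (Set.mem_Icc.2 ⟨h1, h2⟩), truncRV, Set.indicator_of_mem (by exact h2),
        paretoPDFReal, if_pos h1, id, Real.one_rpow, mul_one, smul_eq_mul, mul_assoc,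
        ← Real.rpow_natCast, ← Real.rpow_add hx]
      congr 2
      ring
    -- Beyond `c` the truncated variable is `0`; its power vanishes only because `p ≠ 0`.
    · rw [Set.indicator_of_notMem (fun h => h2 h.2), truncRV,
        Set.indicator_of_notMem (by exact h2), zero_pow hp, smul_zero]
  · rw [Set.indicator_of_notMem (fun h => h1 h.1), paretoPDFReal, if_neg h1, zero_smul]

lemma truncMoment_paretoMeasure_of_ne {α : ℝ} (hα : 0 < α) {p : ℕ} (hp : p ≠ 0) (h : α ≠ p)
    {c : ℝ} (hc : 1 ≤ c) :
    truncMoment (paretoMeasure 1 α) id p c = α / (p - α) * (c ^ (p - α) - 1) := by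
  have h' : (p : ℝ) - α ≠ 0 := sub_ne_zero.2 h.symm
  rw [truncMoment_paretoMeasure_eq_integral hα hp hc, integral_rpow]
  · simp only [sub_add_cancel, Real.one_rpow]
    ring
  · refine .inr ⟨fun e => h' (by linarith), ?_⟩
    rw [Set.uIcc_of_le hc]
    exact fun h => by linarith [h.1]

lemma truncMoment_paretoMeasure_of_eq {p : ℕ} (hp : p ≠ 0) {c : ℝ} (hc : 1 ≤ c) :
    truncMoment (paretoMeasure 1 (p : ℝ)) id p c = p * Real.log c := by
  have hp' : (0 : ℝ) < p := by positivity
  rw [truncMoment_paretoMeasure_eq_integral hp' hp hc]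
  simp only [sub_self, zero_sub, Real.rpow_neg_one]
  rw [integral_inv_of_pos one_pos (by linarith), div_one]

section Asymptotics

variable {α : ℝ} {p : ℕ}

/-- A lower bound for the truncated `p`-th moment of the Pareto law. -/
lemma eventually_le_truncMoment_paretoMeasure (hα : 0 < α) (hp : p ≠ 0) (hαp : α ≤ p) {q : ℝ}
    (hq : q * (p - α) < α) :
    ∀ᶠ c in atTop, q * c ^ (p - α) ≤ truncMoment (paretoMeasure 1 α) id p c := by
  -- When `α = p` the moment is `p log c`, which exceeds every constant `q`.
  rcases hαp.eq_or_lt with rfl | h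
  · have hl : ∀ᶠ c : ℝ in atTop, q ≤ p * Real.log c :=
      (Real.tendsto_log_atTop.const_mul_atTop hα).eventually_ge_atTop q
    filter_upwards [hl, eventually_ge_atTop 1] with c h1 h2
    rw [truncMoment_paretoMeasure_of_eq hp h2]
    simpa using h1
  · have h' : 0 < (p : ℝ) - α := sub_pos.2 h
    have hd : 0 < α / (p - α) - q := sub_pos.2 ((lt_div_iff₀ h').2 hq)
    have hl : ∀ᶠ c : ℝ in atTop, α / (p - α) ≤ (α / (p - α) - q) * c ^ (p - α) :=
      ((tendsto_rpow_atTop h').const_mul_atTop hd).eventually_ge_atTop _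
    filter_upwards [hl, eventually_ge_atTop 1] with c h1 h2
    rw [truncMoment_paretoMeasure_of_ne hα hp h.ne h2]
    linarith

/-- This makes the squared mean negligible in the variance, whose order is `c ^ (2p - α)`. -/
lemma tendsto_truncMoment_paretoMeasure_div (hα : 0 < α) (hp : p ≠ 0) (hαp : α ≤ p) :
    Tendsto (fun c => truncMoment (paretoMeasure 1 α) id p c / c ^ (p - α / 2)) atTop
      (nhds 0) := by
  rcases hαp.eq_or_lt with rfl | h
  · have hl := (isLittleO_log_rpow_atTop (r := (p : ℝ) - p / 2) (by linarith)).tendsto_div_nhds_zero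
    have hl' := hl.const_mul (p : ℝ)
    rw [mul_zero] at hl'
    refine hl'.congr' ?_
    filter_upwards [eventually_ge_atTop 1] with c h2
    rw [truncMoment_paretoMeasure_of_eq hp h2, mul_div_assoc]
  · have h' : 0 < (p : ℝ) - α := sub_pos.2 h
    have l1 := tendsto_rpow_neg_atTop (y := α / 2) (by linarith)
    have l2 := tendsto_rpow_neg_atTop (y := p - α / 2) (by linarith)
    have l3 := (l1.sub l2).const_mul (α / (p - α))
    rw [sub_zero, mul_zero] at l3
    refine l3.congr' ?_
    filter_upwards [eventually_ge_atTop 1] with c h2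
    have hc : 0 < c := by linarith
    rw [truncMoment_paretoMeasure_of_ne hα hp h.ne h2, mul_div_assoc, sub_div, one_div,
      ← Real.rpow_sub hc, Real.rpow_neg hc.le (p - α / 2)]
    congr 3
    ring_nf

lemma truncMoment_two_mul_paretoMeasure_le (hα : 0 < α) (hp : p ≠ 0) (hαp : α ≤ p) {c : ℝ}
    (hc : 1 ≤ c) :
    truncMoment (paretoMeasure 1 α) id (2 * p) c ≤ α / (2 * p - α) * c ^ (2 * p - α) := by
  have hp' : (0 : ℝ) < p := by positivity
  have h : 0 < 2 * (p : ℝ) - α := by linarith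
  rw [truncMoment_paretoMeasure_of_ne hα (by omega) (by push_cast; linarith) hc]
  push_cast
  have : 0 ≤ α / (2 * p - α) := by positivity
  linarith

lemma tendsto_truncMoment_two_mul_paretoMeasure_div (hα : 0 < α) (hp : p ≠ 0) (hαp : α ≤ p) :
    Tendsto (fun c => truncMoment (paretoMeasure 1 α) id (2 * p) c / c ^ (2 * p - α)) atTop
      (nhds (α / (2 * p - α))) := by
  have hp' : (0 : ℝ) < p := by positivity
  have h : 0 < 2 * (p : ℝ) - α := by linarith
  have l := ((tendsto_rpow_neg_atTop h).const_sub 1).const_mul (α / (2 * p - α))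
  rw [sub_zero, mul_one] at l
  refine l.congr' ?_
  filter_upwards [eventually_ge_atTop 1] with c h2
  have hc : 0 < c := by linarith
  have hc' := Real.rpow_pos_of_pos hc (2 * p - α)
  rw [truncMoment_paretoMeasure_of_ne hα (by omega) (by push_cast; linarith) h2,
    Real.rpow_neg hc.le]
  push_cast
  field_simp

end Asymptotics

/-! ### Centred truncated powers: independence, bounds, first two moments. -/

/-- The centred truncated power `(X · 1{X ≤ c}) ^ p - m`. -/
noncomputable def centeredTrunc {Ω : Type*} (X : Ω → ℝ) (p : ℕ) (c m : ℝ) : Ω → ℝ :=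
  fun ω => truncRV X c ω ^ p - m

lemma sum_centeredTrunc_eq {Ω : Type*} {X : ℕ → Ω → ℝ} {p n : ℕ} {c m : ℝ} (hn : n ≠ 0) (ω : Ω) :
    ∑ k ∈ Finset.range n, centeredTrunc (X k) p c m ω = n * (truncSampleMoment X p n c ω - m) := by
  have : (n : ℝ) ≠ 0 := by exact_mod_cast hn
  simp only [centeredTrunc, truncSampleMoment, Finset.sum_sub_distrib, Finset.sum_const,
    Finset.card_range, nsmul_eq_mul]
  field_simp

section Centered

variable {Ω : Type*} [MeasurableSpace Ω] {P : Measure Ω} {α : ℝ} {X : ℕ → Ω → ℝ} {p : ℕ} {c m : ℝ}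

lemma measurable_centeredTrunc_id : Measurable (centeredTrunc (id : ℝ → ℝ) p c m) :=
  ((measurable_truncRV_id c).pow_const p).sub_const m

lemma iIndepFun_centeredTrunc (h : iIndepFun X P) :
    iIndepFun (fun k => centeredTrunc (X k) p c m) P :=
  h.comp (fun _ => centeredTrunc id p c m) fun _ => measurable_centeredTrunc_id

lemma identDistrib_centeredTrunc {μ : Measure ℝ} (h : ∀ k, HasLaw (X k) μ P) (k : ℕ) :
    IdentDistrib (centeredTrunc (X k) p c m) (centeredTrunc (X 0) p c m) P P :=
  IdentDistrib.comp ⟨(h k).aemeasurable, (h 0).aemeasurable, (h k).map_eq.trans (h 0).map_eq.symm⟩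
    measurable_centeredTrunc_id

lemma aemeasurable_truncRV_pow {μ : Measure ℝ} {Y : Ω → ℝ} (h : HasLaw Y μ P) :
    AEMeasurable (fun ω => truncRV Y c ω ^ p) P :=
  ((measurable_truncRV_id c).pow_const p).comp_aemeasurable h.aemeasurable

variable {Y : Ω → ℝ}

lemma ae_truncRV_pow_mem_Icc (h : HasLaw Y (paretoMeasure 1 α) P) (hc : 0 ≤ c) :
    ∀ᵐ ω ∂P, truncRV Y c ω ^ p ∈ Set.Icc 0 (c ^ p) := by
  have h1 : ∀ᵐ ω ∂P, 1 ≤ Y ω :=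
    (h.ae_iff (p := fun x => 1 ≤ x) (measurableSet_setOfPred.1 measurableSet_Ici)).2 (ae_one_le_paretoMeasure α)
  filter_upwards [h1] with ω h1
  have : truncRV Y c ω ∈ Set.Icc 0 c := by
    rw [truncRV_apply, truncRV]
    by_cases h2 : Y ω ≤ c
    · rw [Set.indicator_of_mem (by exact h2)]
      exact ⟨by simp; linarith, h2⟩
    · rw [Set.indicator_of_notMem (by exact h2)]
      exact ⟨le_rfl, hc⟩
  exact ⟨pow_nonneg this.1 p, pow_le_pow_left₀ this.1 this.2 p⟩

lemma ae_abs_centeredTrunc_le (h : HasLaw Y (paretoMeasure 1 α) P) (hc : 0 ≤ c)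
    (hm : m ∈ Set.Icc 0 (c ^ p)) : ∀ᵐ ω ∂P, |centeredTrunc Y p c m ω| ≤ c ^ p := by
  filter_upwards [ae_truncRV_pow_mem_Icc (p := p) h hc] with ω h1
  rw [centeredTrunc, abs_le]
  constructor <;> linarith [h1.1, h1.2, hm.1, hm.2]

variable [IsProbabilityMeasure P]

lemma integrable_truncRV_pow (h : HasLaw Y (paretoMeasure 1 α) P) (hc : 0 ≤ c) :
    Integrable (fun ω => truncRV Y c ω ^ p) P := by
  refine .of_bound (aemeasurable_truncRV_pow h).aestronglyMeasurable (c ^ p) ?_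
  filter_upwards [ae_truncRV_pow_mem_Icc (p := p) h hc] with ω h1
  rw [Real.norm_eq_abs, abs_of_nonneg h1.1]
  exact h1.2

lemma truncMoment_mem_Icc (h : HasLaw Y (paretoMeasure 1 α) P) (hc : 0 ≤ c) :
    truncMoment P Y p c ∈ Set.Icc 0 (c ^ p) := by
  have h1 := ae_truncRV_pow_mem_Icc (p := p) h hc
  refine ⟨integral_nonneg_of_ae (h1.mono fun ω h => h.1), ?_⟩
  have := integral_mono_ae (integrable_truncRV_pow (p := p) h hc) (integrable_const (c ^ p))
    (h1.mono fun ω h => h.2)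
  simpa [truncMoment] using this

lemma integral_centeredTrunc (h : HasLaw Y (paretoMeasure 1 α) P) (hc : 0 ≤ c) :
    ∫ ω, centeredTrunc Y p c (truncMoment P Y p c) ω ∂P = 0 := by
  simp only [centeredTrunc]
  rw [integral_sub (integrable_truncRV_pow h hc) (integrable_const _)]
  simp [truncMoment]

lemma integral_centeredTrunc_sq (h : HasLaw Y (paretoMeasure 1 α) P) (hc : 0 ≤ c) :
    ∫ ω, centeredTrunc Y p c (truncMoment P Y p c) ω ^ 2 ∂P =
      truncMoment P Y (2 * p) c - truncMoment P Y p c ^ 2 := by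
  set m := truncMoment P Y p c with hm
  have e ω : centeredTrunc Y p c m ω ^ 2 =
      truncRV Y c ω ^ (2 * p) - 2 * m * truncRV Y c ω ^ p + m ^ 2 := by
    rw [centeredTrunc]; ring
  have i1 := integrable_truncRV_pow (p := 2 * p) h hc
  have i2 := (integrable_truncRV_pow (p := p) h hc).const_mul (2 * m)
  simp_rw [e]
  rw [integral_add (by exact i1.sub i2) (integrable_const _), integral_sub i1 i2,
    integral_const_mul]
  change truncMoment P Y (2 * p) c - 2 * m * m + _ = _
  simp
  ring

end Centered

/-! ### The concentration inequality at a fixed sample size. -/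

section Concentration

variable {Ω : Type*} [MeasurableSpace Ω] {P : Measure Ω} [IsProbabilityMeasure P]
  {α : ℝ} {X : ℕ → Ω → ℝ} {p : ℕ}

lemma measureReal_truncSampleMoment_deviation_le (hα : 0 < α) (hp : p ≠ 0) (hαp : α ≤ p)
    (hX : iIndepFun X P) (hlaw : ∀ k, HasLaw (X k) (paretoMeasure 1 α) P)
    {c q δ ε : ℝ} {n : ℕ} (hn : n ≠ 0) (hc : 1 ≤ c) (hq : 0 < q) (hδ : 0 < δ) (hδ1 : δ ≤ 1)
    (hε : 0 < ε) (hqδ : α / (2 * p - α) * α * (1 + δ) ≤ q ^ 2)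
    (hm : q * c ^ (p - α) ≤ truncMoment P (X 0) p c)
    (hsmall : q / (α / (2 * p - α) * (1 + δ)) * ε ≤ δ)
    (hgrowth : 4 * Real.log n * c ^ α ≤ α * (n * ε ^ 2)) :
    P.real {ω | |truncSampleMoment X p n c ω - truncMoment P (X 0) p c|
      / truncMoment P (X 0) p c ≥ ε} ≤ 2 / (n : ℝ) ^ 2 := by
  have hc0 : 0 < c := by linarith
  have hp' : (0 : ℝ) < p := by positivity
  have hpα : 0 < 2 * (p : ℝ) - α := by linarith
  set σ := α / (2 * p - α) with hσ
  have hσ0 : 0 < σ := by positivity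
  set m := truncMoment P (X 0) p c with hm_def
  have hca : 0 < c ^ α := Real.rpow_pos_of_pos hc0 _
  have hcb : 0 < c ^ (p - α) := Real.rpow_pos_of_pos hc0 _
  have hm0 : 0 < m := lt_of_lt_of_le (by positivity) hm
  have e1 : c ^ (2 * p - α) = c ^ (p - α) * c ^ (p - α) * c ^ α := by
    rw [← Real.rpow_add hc0, ← Real.rpow_add hc0]; congr 1; ring
  have e2 : c ^ p = c ^ (p - α) * c ^ α := by
    rw [← Real.rpow_add hc0, ← Real.rpow_natCast]; congr 1; ring
  have hn0 : (0 : ℝ) < n := by positivity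
  have hmem := truncMoment_mem_Icc (p := p) (hlaw 0) hc0.le
  have hsq : ∫ ω, centeredTrunc (X 0) p c m ω ^ 2 ∂P ≤ σ * c ^ (2 * p - α) := by
    rw [hm_def, integral_centeredTrunc_sq (hlaw 0) hc0.le]
    have := truncMoment_two_mul_paretoMeasure_le hα hp hαp hc
    rw [← truncMoment_eq_of_hasLaw (hlaw 0)] at this
    linarith [sq_nonneg (truncMoment P (X 0) p c)]
  -- Minimiser of the Chernoff exponent when `m` is replaced by its lower bound `q c ^ (p - α)` and
  -- the variance by `σ c ^ (2p - α)`.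
  set t := q * ε / (σ * (1 + δ) * (c ^ (p - α) * c ^ α)) with ht
  have ht0 : 0 < t := by positivity
  have htB : t * c ^ p ≤ δ := by
    refine le_trans (le_of_eq ?_) hsmall
    rw [ht, e2]
    field_simp
  have key := measureReal_le_abs_sum_le (iIndepFun_centeredTrunc (p := p) (c := c) (m := m) hX)
    (identDistrib_centeredTrunc hlaw)
    (fun k => ae_abs_centeredTrunc_le (hlaw k) hc0.le hmem)
    (integral_centeredTrunc (hlaw 0) hc0.le) hsq ht0.le htB hδ1 hδ.le n (n * (m * ε))
  have hset : {ω | |truncSampleMoment X p n c ω - m| / m ≥ ε} =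
      {ω | n * (m * ε) ≤ |∑ k ∈ Finset.range n, centeredTrunc (X k) p c m ω|} := by
    ext ω
    simp only [Set.mem_ofPred_eq, ge_iff_le]
    rw [sum_centeredTrunc_eq hn, abs_mul, abs_of_pos hn0, le_div_iff₀ hm0, mul_comm ε,
      mul_le_mul_iff_right₀ hn0]
  rw [hset]
  refine key.trans ?_
  rw [div_eq_mul_inv]
  refine mul_le_mul_of_nonneg_left ?_ zero_le_two
  have hexp : ((n : ℝ) ^ 2)⁻¹ = Real.exp (-(2 * Real.log n)) := by
    rw [Real.exp_neg, mul_comm, Real.exp_mul, Real.exp_log hn0, Real.rpow_two]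
  rw [hexp, Real.exp_le_exp]
  have s1 : t * (n * (q * c ^ (p - α) * ε)) ≤ t * (n * (m * ε)) := by gcongr
  have s2 : -t * (n * (q * c ^ (p - α) * ε)) +
      n * (t ^ 2 * (σ * c ^ (2 * p - α)) / 2 * (1 + δ)) =
      -((q ^ 2 / (σ * α * (1 + δ))) * ((α * (n * ε ^ 2)) / (2 * c ^ α))) := by
    rw [e1, ht]
    field_simp
    ring
  have s3 : 1 ≤ q ^ 2 / (σ * α * (1 + δ)) := (one_le_div (by positivity)).2 hqδ
  have s4 : 2 * Real.log n ≤ (α * (n * ε ^ 2)) / (2 * c ^ α) := by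
    rw [le_div_iff₀ (by positivity)]
    linarith
  have s5 : (0 : ℝ) ≤ (α * (n * ε ^ 2)) / (2 * c ^ α) := by positivity
  have s6 := le_mul_of_one_le_left s5 s3
  linarith

end Concentration

/-! ### Consequences of the growth condition on the truncation levels. -/

section Growth

variable {α β : ℝ} {b : ℕ → ℝ}

lemma four_mul_log_mul_rpow_le {c ε : ℝ} {n : ℕ} (hn : 2 ≤ n) (hc : 1 < c)
    (hε : ε = 2 / ((n : ℝ) ^ β * √(Real.log c)))
    (h : c ^ α * Real.log c ≤ α * (n : ℝ) ^ (1 - 2 * β) / Real.log n) :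
    4 * Real.log n * c ^ α ≤ α * (n * ε ^ 2) := by
  have hn1 : (1 : ℝ) < n := by exact_mod_cast hn
  have hn0 : (0 : ℝ) < n := by linarith
  have hl := Real.log_pos hn1
  have hlc := Real.log_pos hc
  have hb : 0 < (n : ℝ) ^ β := Real.rpow_pos_of_pos hn0 _
  have e : (n : ℝ) ^ (1 - 2 * β) = n / ((n : ℝ) ^ β) ^ 2 := by
    rw [Real.rpow_sub hn0, Real.rpow_one, two_mul, Real.rpow_add hn0, sq]
  rw [le_div_iff₀ hl, e] at h
  have e2 : α * (n * ε ^ 2) = 4 * (α * (n / ((n : ℝ) ^ β) ^ 2)) / Real.log c := by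
    rw [hε, div_pow, mul_pow, Real.sq_sqrt hlc.le]
    field_simp
    ring
  rw [e2, le_div_iff₀ hlc]
  linarith

lemma tendsto_two_div_rpow_mul_sqrt_log (hβ : 0 ≤ β) (hb : Tendsto b atTop atTop) :
    Tendsto (fun n : ℕ => 2 / ((n : ℝ) ^ β * √(Real.log (b n)))) atTop (nhds 0) := by
  have h1 : Tendsto (fun n => √(Real.log (b n))) atTop atTop :=
    Real.tendsto_sqrt_atTop.comp (Real.tendsto_log_atTop.comp hb)
  refine Tendsto.const_div_atTop ?_ 2
  refine tendsto_atTop_mono' _ ?_ h1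
  filter_upwards [eventually_ge_atTop 1] with n hn
  refine le_mul_of_one_le_left (Real.sqrt_nonneg _) (Real.one_le_rpow ?_ hβ)
  exact_mod_cast hn

/-- This ratio is the bound on a summand relative to the normalisation of the sum. Its square is at
most `α / log (b n)` once `log n ≥ 1`. -/
lemma tendsto_rpow_half_div_sqrt (hα : 0 < α) (hβ : 0 ≤ β) (hb : Tendsto b atTop atTop)
    (hg : ∀ᶠ n : ℕ in atTop,
      b n ^ α * Real.log (b n) ≤ α * (n : ℝ) ^ (1 - 2 * β) / Real.log n) :
    Tendsto (fun n : ℕ => b n ^ (α / 2) / √(n : ℝ)) atTop (nhds 0) := by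
  have h1 : Tendsto (fun n : ℕ => b n ^ α / n) atTop (nhds 0) := by
    have h2 : Tendsto (fun n => α / Real.log (b n)) atTop (nhds 0) :=
      (Real.tendsto_log_atTop.comp hb).const_div_atTop α
    refine squeeze_zero' ?_ ?_ h2
    · filter_upwards [hb.eventually_ge_atTop 0] with n hn
      positivity
    · filter_upwards [hg, hb.eventually_gt_atTop 1, eventually_ge_atTop 3] with n h hb1 hn
      have hn3 : (3 : ℝ) ≤ n := by exact_mod_cast hn
      have hn0 : (0 : ℝ) < n := by linarith
      have hl : 1 ≤ Real.log n := by
        rw [Real.le_log_iff_exp_le hn0]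
        linarith [Real.exp_one_lt_d9]
      have hr : (n : ℝ) ^ (1 - 2 * β) ≤ n := by
        refine (Real.rpow_le_rpow_of_exponent_le (z := 1) (by linarith) (by linarith)).trans_eq ?_
        exact Real.rpow_one _
      rw [div_le_div_iff₀ hn0 (Real.log_pos hb1)]
      refine h.trans ((div_le_self (by positivity) hl).trans ?_)
      gcongr
  have h3 := (Real.continuous_sqrt.tendsto 0).comp h1
  rw [Real.sqrt_zero] at h3
  refine h3.congr' ?_
  filter_upwards [hb.eventually_ge_atTop 0] with n hn
  rw [Function.comp_apply, Real.sqrt_div (by positivity), Real.sqrt_eq_rpow (b n ^ α),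
    ← Real.rpow_mul hn, mul_one_div]

end Growth

/-! ### Choice of constants, and both limit statements for general `p`. -/

section Main

variable {Ω : Type*} [MeasurableSpace Ω] {P : Measure Ω} [IsProbabilityMeasure P]
  {α β : ℝ} {X : ℕ → Ω → ℝ} {p : ℕ} {b : ℕ → ℝ}

/-- At `δ = 0` the last condition is an equality for `q₀ = α / √(2r - α)`, and the hypothesis says
exactly that `q₀ (r - α) < α` strictly. The slack lets `q₀` grow to `q₀ + e`, which leaves room for
a positive `δ`. -/
lemma exists_moment_constant (hα : 0 < α) {r : ℝ} (hαr : α ≤ r) (h : (r - α) ^ 2 < 2 * r - α) :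
    ∃ q δ : ℝ, 0 < q ∧ 0 < δ ∧ δ ≤ 1 ∧ q * (r - α) < α ∧
      α / (2 * r - α) * α * (1 + δ) ≤ q ^ 2 := by
  have hd : 0 ≤ r - α := by linarith
  have hpos : 0 < 2 * r - α := by linarith
  have hs : 0 < √(2 * r - α) := Real.sqrt_pos.2 hpos
  have hlt : r - α < √(2 * r - α) := Real.lt_sqrt_of_sq_lt h
  set q₀ := α / √(2 * r - α) with hq₀
  have hq₀_pos : 0 < q₀ := by positivity
  have hq₀_sq : q₀ ^ 2 = α / (2 * r - α) * α := by
    rw [hq₀, div_pow, Real.sq_sqrt hpos.le]; ring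
  have hgap : 0 < α - q₀ * (r - α) := by
    rw [hq₀, sub_pos, div_mul_eq_mul_div, div_lt_iff₀ hs]
    gcongr
  -- The `+ 1` keeps the denominator positive when `r = α` and makes `e (r - α)` smaller than the
  -- slack.
  set e := (α - q₀ * (r - α)) / (r - α + 1) with he
  have he0 : 0 < e := by positivity
  have hed : e * (r - α) < α - q₀ * (r - α) := by
    rw [he, div_mul_eq_mul_div, div_lt_iff₀ (by linarith)]
    nlinarith
  refine ⟨q₀ + e, min 1 (e / q₀), by positivity, by positivity, min_le_left _ _, by linarith, ?_⟩
  rw [← hq₀_sq]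
  calc q₀ ^ 2 * (1 + min 1 (e / q₀)) ≤ q₀ ^ 2 * (1 + e / q₀) := by
        gcongr
        exact min_le_right _ _
    _ = q₀ ^ 2 + q₀ * e := by field_simp
    _ ≤ (q₀ + e) ^ 2 := by nlinarith [mul_pos hq₀_pos he0]

/-- Concentration of the truncated sample moment of a Pareto sample. -/
theorem eventually_measureReal_truncSampleMoment_deviation_le (hα : 0 < α) (hp : p ≠ 0)
    (hαp : α ≤ p) (hαp2 : ((p : ℝ) - α) ^ 2 < 2 * p - α) (hβ : 0 ≤ β)
    (hX : iIndepFun X P) (hlaw : ∀ k, HasLaw (X k) (paretoMeasure 1 α) P)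
    (hb : Tendsto b atTop atTop)
    (hg : ∀ᶠ n : ℕ in atTop,
      b n ^ α * Real.log (b n) ≤ α * (n : ℝ) ^ (1 - 2 * β) / Real.log n) :
    ∀ᶠ n : ℕ in atTop,
      P.real {ω | |truncSampleMoment X p n (b n) ω - truncMoment P (X 0) p (b n)|
            / truncMoment P (X 0) p (b n)
          ≥ 2 / ((n : ℝ) ^ β * √(Real.log (b n)))} ≤ 2 / (n : ℝ) ^ 2 := by
  obtain ⟨q, δ, hq, hδ, hδ1, hqα, hqδ⟩ := exists_moment_constant hα hαp hαp2
  have hε := (tendsto_two_div_rpow_mul_sqrt_log hβ hb).const_mul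
    (q / (α / (2 * p - α) * (1 + δ)))
  rw [mul_zero] at hε
  filter_upwards [hg, hb.eventually_gt_atTop 1, eventually_ge_atTop 2,
    hε.eventually_le_const hδ, hb.eventually (eventually_le_truncMoment_paretoMeasure hα hp hαp hqα)]
    with n h1 h2 h3 h4 h5
  rw [← truncMoment_eq_of_hasLaw (hlaw 0)] at h5
  have hn0 : (0 : ℝ) < n := by positivity
  have hl := Real.log_pos h2
  exact measureReal_truncSampleMoment_deviation_le hα hp hαp hX hlaw (by omega) h2.le hq hδ hδ1
    (by positivity) hqδ h5 h4 (four_mul_log_mul_rpow_le h3 h2 rfl h1)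

/-- Asymptotic normality of the truncated sample moment of a Pareto sample. -/
theorem tendstoInDistribution_truncSampleMoment (hα : 0 < α) (hp : p ≠ 0)
    (hαp : α ≤ p) (hβ : 0 ≤ β)
    (hX : iIndepFun X P) (hlaw : ∀ k, HasLaw (X k) (paretoMeasure 1 α) P)
    (hb : Tendsto b atTop atTop)
    (hg : ∀ᶠ n : ℕ in atTop,
      b n ^ α * Real.log (b n) ≤ α * (n : ℝ) ^ (1 - 2 * β) / Real.log n) :
    TendstoInDistribution
      (fun (n : ℕ) ω =>
        √(n : ℝ) * (truncSampleMoment X p n (b n) ω - truncMoment P (X 0) p (b n))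
          / b n ^ (p - α / 2))
      atTop (id : ℝ → ℝ) (fun _ => P) (gaussianReal 0 (Real.toNNReal (α / (2 * p - α)))) := by
  have hp' : (0 : ℝ) < p := by positivity
  have hpα : 0 < 2 * (p : ℝ) - α := by linarith
  set m : ℕ → ℝ := fun n => truncMoment P (X 0) p (b n) with hm
  set s : ℕ → ℝ := fun n => √(n : ℝ) * b n ^ (p - α / 2) with hs
  have hsum : (fun (n : ℕ) ω =>
        √(n : ℝ) * (truncSampleMoment X p n (b n) ω - m n) / b n ^ (p - α / 2)) =
      fun n ω => ∑ k ∈ Finset.range n, centeredTrunc (X k) p (b n) (m n) ω / s n := by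
    ext n ω
    rcases eq_or_ne n 0 with rfl | hn
    -- At `n = 0` both sides are `0`: `√0 = 0` and the sum is empty.
    · simp
    · have hn0 : (0 : ℝ) < n := by positivity
      rw [← Finset.sum_div, sum_centeredTrunc_eq hn, hs]
      simp only
      rw [mul_div_mul_comm, Real.div_sqrt, mul_div_assoc]
  rw [hsum]
  refine tendstoInDistribution_sum_of_bounded_rows
    (W := fun n k ω => centeredTrunc (X k) p (b n) (m n) ω / s n) (by positivity)
    (fun n => (iIndepFun_centeredTrunc hX).comp (fun _ x => x / s n) fun _ => by fun_prop)
    (fun n k => (identDistrib_centeredTrunc hlaw k).comp (u := fun x => x / s n) (by fun_prop))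
    ?_ (tendsto_rpow_half_div_sqrt hα hβ hb hg) ?_ ?_
  · filter_upwards [hb.eventually_gt_atTop 1, eventually_ge_atTop 1] with n hn hn1
    have hb0 : 0 < b n := by linarith
    have hn0 : (0 : ℝ) < n := by positivity
    have hs0 : 0 < s n := by positivity
    filter_upwards [ae_abs_centeredTrunc_le (hlaw 0) hb0.le
      (truncMoment_mem_Icc (p := p) (hlaw 0) hb0.le)] with ω h
    rw [abs_div, abs_of_pos hs0, div_le_iff₀ hs0]
    refine h.trans_eq ?_
    have e : b n ^ p = b n ^ (α / 2) * b n ^ (p - α / 2) := by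
      rw [← Real.rpow_add hb0, ← Real.rpow_natCast]; congr 1; ring
    rw [e, hs]
    field_simp
  · filter_upwards [hb.eventually_ge_atTop 0] with n hn
    rw [integral_div, integral_centeredTrunc (hlaw 0) hn, zero_div]
  · have l1 := (tendsto_truncMoment_two_mul_paretoMeasure_div hα hp hαp).comp hb
    have l2 := ((tendsto_truncMoment_paretoMeasure_div hα hp hαp).comp hb).pow 2
    have l3 := l1.sub l2
    rw [zero_pow two_ne_zero, sub_zero] at l3
    refine l3.congr' ?_
    filter_upwards [hb.eventually_gt_atTop 1, eventually_ge_atTop 1] with n hn hn1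
    have hb0 : 0 < b n := by linarith
    have hn0 : (0 : ℝ) < n := by positivity
    have e : b n ^ (2 * p - α) = (b n ^ (p - α / 2)) ^ 2 := by
      rw [← Real.rpow_natCast, ← Real.rpow_mul hb0.le]; congr 1; push_cast; ring
    have e0 : 0 < b n ^ (p - α / 2) := Real.rpow_pos_of_pos hb0 _
    simp only [div_pow, Function.comp_apply]
    rw [integral_div, integral_centeredTrunc_sq (hlaw 0) hb0.le, hs, e,
      truncMoment_eq_of_hasLaw (hlaw 0), truncMoment_eq_of_hasLaw (hlaw 0), mul_pow,
      Real.sq_sqrt hn0.le]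
    field_simp

end Main

theorem theorem2 {Ω : Type*} [MeasurableSpace Ω] (P : Measure Ω) [IsProbabilityMeasure P]
    (α β : ℝ) (hα_pos : 0 < α) (hα_le : α ≤ 2) (hβ_nonneg : 0 ≤ β) (hβ_lt : β < 1 / 2)
    (X : ℕ → Ω → ℝ) (hX_indep : iIndepFun X P)
    (hX_law : ∀ k, HasLaw (X k) (paretoMeasure 1 α) P)
    (b : ℕ → ℝ) (hb : IsTruncationSequence b)
    (hb_growth : ∀ᶠ n : ℕ in atTop,
      b n ^ α * Real.log (b n) ≤ α * (n : ℝ) ^ (1 - 2 * β) / Real.log n) :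
    (α ≤ 1 →
      (∀ᶠ n : ℕ in atTop,
        P.real {ω | |truncSampleMoment X 1 n (b n) ω - truncMoment P (X 0) 1 (b n)|
              / truncMoment P (X 0) 1 (b n)
            ≥ 2 / ((n : ℝ) ^ β * √(Real.log (b n)))} ≤ 2 / (n : ℝ) ^ 2) ∧
      TendstoInDistribution
        (fun (n : ℕ) ω =>
          √(n : ℝ) * (truncSampleMoment X 1 n (b n) ω - truncMoment P (X 0) 1 (b n))
            / b n ^ (1 - α / 2))
        atTop (id : ℝ → ℝ) (fun _ => P) (gaussianReal 0 (Real.toNNReal (α / (2 - α))))) ∧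
    (1 < α →
      (∀ᶠ n : ℕ in atTop,
        P.real {ω | |truncSampleMoment X 2 n (b n) ω - truncMoment P (X 0) 2 (b n)|
              / truncMoment P (X 0) 2 (b n)
            ≥ 2 / ((n : ℝ) ^ β * √(Real.log (b n)))} ≤ 2 / (n : ℝ) ^ 2) ∧
      TendstoInDistribution
        (fun (n : ℕ) ω =>
          √(n : ℝ) * (truncSampleMoment X 2 n (b n) ω - truncMoment P (X 0) 2 (b n))
            / b n ^ (2 - α / 2))
        atTop (id : ℝ → ℝ) (fun _ => P) (gaussianReal 0 (Real.toNNReal (α / (4 - α))))) := by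
  refine ⟨fun h1 => ?_, fun h1 => ?_⟩
  · have hαp : α ≤ (1 : ℕ) := by simpa using h1
    refine ⟨eventually_measureReal_truncSampleMoment_deviation_le hα_pos one_ne_zero hαp ?_
      hβ_nonneg hX_indep hX_law hb.tendsto hb_growth, ?_⟩
    -- For `p = 1` the condition reads `α² < α + 1`, which follows from `0 < α ≤ 1`.
    · push_cast
      nlinarith
    · simpa using tendstoInDistribution_truncSampleMoment hα_pos one_ne_zero hαp
        hβ_nonneg hX_indep hX_law hb.tendsto hb_growth
  · have hαp : α ≤ (2 : ℕ) := by simpa using hα_le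
    refine ⟨eventually_measureReal_truncSampleMoment_deviation_le hα_pos two_ne_zero hαp ?_
      hβ_nonneg hX_indep hX_law hb.tendsto hb_growth, ?_⟩
    -- For `p = 2` the condition reads `α² < 3α`, which follows from `0 < α ≤ 2`.
    · push_cast
      nlinarith
    · have := tendstoInDistribution_truncSampleMoment hα_pos two_ne_zero hαp
        hβ_nonneg hX_indep hX_law hb.tendsto hb_growth
      norm_num at this
      exact this
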